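/- Let $X$ be a proper CAT(0) space and let $G$ be a group acting geometrically (that is, by isometries, properly discontinuously and cocompactly) on $X$. A subgroup $H \le G$ is called convex if $H$ leaves invariant some nonempty closed convex subset $Y \subseteq X$ and acts geometrically on it. Let $\partial X$ be the visual boundary of $X$; the limit set $\Lambda H = \partial X \cap \overline{Hx}$ is the set of points of $\partial X$ in the closure of an orbit $Hx$ in $X \cup \partial X$ with the visual topology (it does not depend on $x \in X$). For a closed convex $C \subseteq X$, let $\partial C \subseteq \partial X$ be the set of classes of geodesic rays contained in $C$. A nonempty closed convex set $C \subseteq X$ is boundary minimal if every nonempty closed convex $B \subseteq C$ with $\partial B = \partial C$ equals $C$; it is boundary minimal with respect to $\Lambda$ if moreover $\partial C = \Lambda$. (1) Let $H$ be a convex subgroup of $G$. Then there is a nonempty closed convex set $Z \subseteq X$, boundary minimal with respect to $\Lambda H$, which is invariant under $H$ and on which $H$ acts geometrically. (2) If $A, B \subseteq X$ are boundary minimal closed convex sets with $\partial A = \partial B$, then $A$ and $B$ are parallel, that is, the closest-point projections $\pi_A \colon B \to A$ and $\pi_B \colon A \to B$ are inverse to each other. -/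

import Mathlib

open Set Topology
open scoped NNReal

namespace CatZero

section Defs

universe u

/-- `γ`, restricted to `[0, d(x, y)]`, is a geodesic segment from `x` to `y`. -/
def IsGeodesicSegment {X : Type u} [MetricSpace X] (γ : ℝ → X) (x y : X) : Prop :=
  γ 0 = x ∧ γ (dist x y) = y ∧
    ∀ s ∈ Icc (0 : ℝ) (dist x y), ∀ t ∈ Icc (0 : ℝ) (dist x y), dist (γ s) (γ t) = |s - t|

/-- A CAT(0) space: a geodesic metric space all of whose geodesic triangles are at least as thin as
their Euclidean comparison triangles. Two points of a triangle lie on two sides with a common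
vertex, here called `a`, and the names of the vertices are arbitrary. -/
structure IsCAT0 (X : Type u) [MetricSpace X] : Prop where
  geodesic : ∀ x y : X, ∃ γ : ℝ → X, IsGeodesicSegment γ x y
  thin : ∀ (a b c : X) (α β : ℝ → X), IsGeodesicSegment α a b → IsGeodesicSegment β a c →
    ∀ a' b' c' : EuclideanSpace ℝ (Fin 2),
      dist a' b' = dist a b → dist a' c' = dist a c → dist b' c' = dist b c →
      ∀ s ∈ Icc (0 : ℝ) 1, ∀ t ∈ Icc (0 : ℝ) 1,
        dist (α (s * dist a b)) (β (t * dist a c)) ≤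
          dist (AffineMap.lineMap a' b' s : EuclideanSpace ℝ (Fin 2))
            (AffineMap.lineMap a' c' t : EuclideanSpace ℝ (Fin 2))

/-- Geodesic convexity of a subset. -/
def IsGeodConvex {X : Type u} [MetricSpace X] (C : Set X) : Prop :=
  ∀ x ∈ C, ∀ y ∈ C, ∀ γ : ℝ → X, IsGeodesicSegment γ x y →
    ∀ t ∈ Icc (0 : ℝ) (dist x y), γ t ∈ C

/-- Nonempty closed convex subsets. -/
structure IsClosedConvex {X : Type u} [MetricSpace X] (C : Set X) : Prop where
  nonempty : C.Nonempty
  closed : IsClosed C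
  convex : IsGeodConvex C

/-- Geodesic rays `[0, ∞) → X`. -/
structure GeodesicRay (X : Type u) [MetricSpace X] where
  toFun : ℝ≥0 → X
  isometry : Isometry toFun

/-- Two rays are equivalent if they stay at bounded distance from each other. -/
def rayEquiv (X : Type u) [MetricSpace X] : Setoid (GeodesicRay X) where
  r α β := ∃ K : ℝ, ∀ t : ℝ≥0, dist (α.toFun t) (β.toFun t) ≤ K
  iseqv :=
    { refl := fun _ => ⟨0, fun _ => by simp⟩
      symm := fun ⟨K, hK⟩ => ⟨K, fun t => by rw [dist_comm]; exact hK t⟩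
      trans := fun ⟨K, hK⟩ ⟨L, hL⟩ =>
        ⟨K + L, fun t => (dist_triangle _ _ _).trans (add_le_add (hK t) (hL t))⟩ }

/-- The visual boundary `∂X`, as a set. -/
def Boundary (X : Type u) [MetricSpace X] : Type u := Quotient (rayEquiv X)

/-- The endpoint at infinity of a ray. -/
def GeodesicRay.endpoint {X : Type u} [MetricSpace X] (α : GeodesicRay X) : Boundary X :=
  Quotient.mk (rayEquiv X) α

/-- The boundary `∂C ⊆ ∂X` of a closed convex subset `C`: the classes of the rays in `C`. -/
def boundaryOf {X : Type u} [MetricSpace X] (C : Set X) : Set (Boundary X) :=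
  {ξ | ∃ α : GeodesicRay X, (∀ t, α.toFun t ∈ C) ∧ α.endpoint = ξ}

/-- The basic neighbourhood `U(α, n, ε)` in `X ∪ ∂X` of the endpoint of the ray `α` from `x₀`: the
points `p` such that the geodesic `β` from `x₀` to `p` is longer than `n` and satisfies
`d(α(n), β(n)) < ε`. -/
def coneNhd {X : Type u} [MetricSpace X] (x₀ : X) (α : GeodesicRay X) (n : ℝ≥0) (ε : ℝ) :
    Set (X ⊕ Boundary X) :=
  Sum.inl '' {x | (n : ℝ) < dist x₀ x ∧
      ∃ β : ℝ → X, IsGeodesicSegment β x₀ x ∧ dist (α.toFun n) (β n) < ε} ∪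
  Sum.inr '' {ξ | ∃ β : GeodesicRay X, β.toFun 0 = x₀ ∧ β.endpoint = ξ ∧
      dist (α.toFun n) (β.toFun n) < ε}

/-- The visual (cone) topology on `X ∪ ∂X` with base point `x₀`. For a proper CAT(0) space it does
not depend on `x₀`. -/
@[reducible] def coneTopology {X : Type u} [MetricSpace X] (x₀ : X) : TopologicalSpace (X ⊕ Boundary X) :=
  TopologicalSpace.generateFrom
    ({U | ∃ (x : X) (r : ℝ), U = Sum.inl '' Metric.ball x r} ∪
      {U | ∃ (α : GeodesicRay X) (n : ℝ≥0) (ε : ℝ), α.toFun 0 = x₀ ∧ 0 < n ∧ 0 < ε ∧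
        U = coneNhd x₀ α n ε})

/-- The limit set of a group acting on `X`: the points of `∂X` in the closure of the orbit of `x`,
where `X ∪ ∂X` has the visual topology with base point `x₀`. -/
def limitSet (H : Type*) {X : Type u} [Group H] [MetricSpace X] [MulAction H X] (x₀ x : X) :
    Set (Boundary X) :=
  {ξ | (Sum.inr ξ : X ⊕ Boundary X) ∈ closure[coneTopology x₀] (Sum.inl '' MulAction.orbit H x)}

/-- The group `H` preserves the subset `S` of `X` and acts on it geometrically: by isometries,
properly discontinuously and cocompactly. -/
structure ActsGeometricallyOn (H : Type*) {X : Type u} [Group H] [MetricSpace X] [MulAction H X]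
    (S : Set X) : Prop where
  invariant : ∀ h : H, ∀ x ∈ S, h • x ∈ S
  isometric : ∀ h : H, ∀ x ∈ S, ∀ y ∈ S, dist (h • x) (h • y) = dist x y
  proper : ∀ K ⊆ S, IsCompact K → {h : H | ((fun x => h • x) '' K ∩ K).Nonempty}.Finite
  cocompact : ∃ K ⊆ S, IsCompact K ∧ ∀ x ∈ S, ∃ h : H, ∃ k ∈ K, h • k = x

/-- A subgroup is convex if it acts geometrically on some nonempty closed convex subset of `X`. -/
def IsConvexSubgroup {G : Type*} (X : Type u) [Group G] [MetricSpace X] [MulAction G X]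
    (H : Subgroup G) : Prop :=
  ∃ Y : Set X, IsClosedConvex Y ∧ ActsGeometricallyOn H Y

/-- A nonempty closed convex set with no proper nonempty closed convex subset having the same
boundary. -/
def IsBoundaryMinimal {X : Type u} [MetricSpace X] (C : Set X) : Prop :=
  IsClosedConvex C ∧
    ∀ B : Set X, IsClosedConvex B → B ⊆ C → boundaryOf B = boundaryOf C → B = C

open Classical in
/-- Closest-point projection to `C`. In a proper CAT(0) space every point has exactly one closest
point in a nonempty closed convex set `C`. -/
noncomputable def proj {X : Type u} [MetricSpace X] (C : Set X) (x : X) : X :=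
  if h : ∃ p ∈ C, ∀ c ∈ C, dist x p ≤ dist x c then h.choose else x

/-- `A` and `B` are parallel: the projections `B → A` and `A → B` are inverse to each other. -/
def Parallel {X : Type u} [MetricSpace X] (A B : Set X) : Prop :=
  InvOn (proj A) (proj B) A B

end Defs

end CatZero

namespace CatZero

/-! ### Comparison geometry: the CN inequality, convexity of the metric, projections. -/

section Basics

universe u

/-! A convex function bounded on every ray of a boundary minimal set `C` is constant there: it does
not increase along rays, so each nonempty sublevel set contains a ray to every point of `∂C` and
hence is all of `C` (`IsBoundaryMinimal.eq_of_convex`). Applied to the distance to `B` on `A`, this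
makes `A` and `B` equidistant, which gives (2).

For (1), Zorn and cocompactness give a minimal invariant closed convex `Z ⊆ Y`. A limiting argument
shows that closed convex subsets of `Z` with full boundary are uniformly dense
(`IsClosedConvex.exists_infDist_le`), so `Z` contains a boundary minimal `B` with `∂B = ∂Z`. Its
translates are pairwise parallel, and projecting around a triangle of them is the identity
(`IsBoundaryMinimal.proj_proj_proj`): otherwise it would be a translation, and a long detour through
the three sets would be too short. By minimality of `Z`, the supremum of the distances to the
translates is constant on `Z`. If two translates differed, a midpoint between them would have a
smaller supremum, by CN. So `B` is invariant and equals `Z`. Finally `∂Z` is the limit set, since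
orbits of points of `Z` are coarsely dense in `Z`. -/

theorem exists_comparison_triangle {p q r : ℝ} (hp : 0 ≤ p) (hq : 0 ≤ q) (hr : 0 ≤ r)
    (h1 : p ≤ q + r) (h2 : q ≤ p + r) (h3 : r ≤ p + q) :
    ∃ a b c : EuclideanSpace ℝ (Fin 2), dist a b = p ∧ dist a c = q ∧ dist b c = r := by
  rcases hp.eq_or_lt with rfl | hp'
  · have : q = r := le_antisymm (by linarith) (by linarith)
    subst this
    refine ⟨!₂[0, 0], !₂[0, 0], !₂[q, 0], ?_, ?_, ?_⟩ <;>
      simp [EuclideanSpace.dist_eq, Real.sqrt_sq_eq_abs, abs_of_nonneg hq, Real.dist_eq]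
  -- The abscissa of the third vertex, from the law of cosines, with the first side on the axis.
  · set w := (p ^ 2 + q ^ 2 - r ^ 2) / (2 * p) with hw
    have hwp : 2 * p * w = p ^ 2 + q ^ 2 - r ^ 2 := by rw [hw]; field_simp
    have hwq : w ^ 2 ≤ q ^ 2 := by
      apply sq_le_sq'
      · by_contra! h
        have := mul_lt_mul_of_pos_left h (by linarith : 0 < 2 * p)
        nlinarith
      · by_contra! h
        have := mul_lt_mul_of_pos_left h (by linarith : 0 < 2 * p)
        nlinarith
    have hv : Real.sqrt (q ^ 2 - w ^ 2) ^ 2 = q ^ 2 - w ^ 2 := Real.sq_sqrt (by linarith)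
    refine ⟨!₂[0, 0], !₂[p, 0], !₂[w, Real.sqrt (q ^ 2 - w ^ 2)], ?_, ?_, ?_⟩
    · simp [EuclideanSpace.dist_eq, Real.sqrt_sq_eq_abs, abs_of_nonneg hp, Real.dist_eq]
    · rw [EuclideanSpace.dist_eq, Real.sqrt_eq_iff_eq_sq (by positivity) hq]
      simp only [Fin.sum_univ_two, Real.dist_eq, sq_abs]
      simp only [Matrix.cons_val_zero, Matrix.cons_val_one]
      linarith
    · rw [EuclideanSpace.dist_eq, Real.sqrt_eq_iff_eq_sq (by positivity) hr]
      simp only [Fin.sum_univ_two, Real.dist_eq, sq_abs]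
      simp only [Matrix.cons_val_zero, Matrix.cons_val_one]
      linarith

theorem dist_lineMap_sq {V : Type*} [NormedAddCommGroup V] [InnerProductSpace ℝ V] (a b c : V)
    (s : ℝ) : dist (AffineMap.lineMap a b s) c ^ 2 =
      (1 - s) * dist a c ^ 2 + s * dist b c ^ 2 - s * (1 - s) * dist a b ^ 2 := by
  have e1 : (AffineMap.lineMap a b s : V) - c = (1 - s) • (a - c) + s • (b - c) := by
    rw [AffineMap.lineMap_apply_module]
    module
  have e2 : a - b = (a - c) - (b - c) := by abel
  rw [dist_eq_norm, dist_eq_norm, dist_eq_norm, dist_eq_norm, e1, e2, norm_add_sq_real,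
    norm_sub_sq_real (a - c) (b - c), norm_smul, norm_smul, inner_smul_left, inner_smul_right, mul_pow, mul_pow,
    Real.norm_eq_abs, Real.norm_eq_abs, sq_abs, sq_abs]
  simp only [conj_trivial]
  ring

variable {X : Type u} [MetricSpace X]

theorem IsGeodesicSegment.symm {γ : ℝ → X} {x y : X} (h : IsGeodesicSegment γ x y) :
    IsGeodesicSegment (fun t => γ (dist x y - t)) y x := by
  obtain ⟨h0, h1, h2⟩ := h
  refine ⟨by simpa using h1, by simpa [dist_comm y x] using h0, ?_⟩
  intro s hs t ht
  rw [dist_comm y x] at hs ht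
  rw [h2 _ ⟨by linarith [hs.2], by linarith [hs.1]⟩ _ ⟨by linarith [ht.2], by linarith [ht.1]⟩,
    abs_sub_comm]
  congr 1
  ring

/-- The inequality of Courbure Négative of Bruhat and Tits, for an arbitrary point of a segment. -/
theorem IsCAT0.cn (hX : IsCAT0 X) {γ : ℝ → X} {x y : X} (h : IsGeodesicSegment γ x y) (p : X)
    {s : ℝ} (hs : s ∈ Icc (0 : ℝ) 1) :
    dist (γ (s * dist x y)) p ^ 2 ≤
      (1 - s) * dist x p ^ 2 + s * dist y p ^ 2 - s * (1 - s) * dist x y ^ 2 := by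
  obtain ⟨β, hβ⟩ := hX.geodesic x p
  obtain ⟨a', b', c', hab, hac, hbc⟩ := exists_comparison_triangle (p := dist x y)
    (q := dist x p) (r := dist y p) dist_nonneg dist_nonneg dist_nonneg
    (by linarith [dist_triangle x p y, dist_comm y p]) (dist_triangle _ _ _)
    (by linarith [dist_triangle y x p, dist_comm x y])
  have key := hX.thin x y p γ β h hβ a' b' c' hab hac hbc s hs 1 ⟨zero_le_one, le_rfl⟩
  rw [one_mul, hβ.2.1, AffineMap.lineMap_apply_one] at key
  calc _ ≤ _ := pow_le_pow_left₀ dist_nonneg key 2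
    _ = _ := by rw [dist_lineMap_sq, hab, hac, hbc]

/-- The point dividing the geodesic segment from `x` to `y` in the ratio `s : 1 - s`. -/
noncomputable def IsCAT0.mix (hX : IsCAT0 X) (x y : X) (s : ℝ) : X :=
  (hX.geodesic x y).choose (s * dist x y)

theorem mul_dist_mem_Icc (x y : X) {s : ℝ} (hs : s ∈ Icc (0 : ℝ) 1) :
    s * dist x y ∈ Icc (0 : ℝ) (dist x y) :=
  ⟨mul_nonneg hs.1 dist_nonneg, mul_le_of_le_one_left dist_nonneg hs.2⟩

theorem IsCAT0.mix_zero (hX : IsCAT0 X) (x y : X) : hX.mix x y 0 = x := by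
  simpa [IsCAT0.mix] using (hX.geodesic x y).choose_spec.1

theorem IsCAT0.mix_one (hX : IsCAT0 X) (x y : X) : hX.mix x y 1 = y := by
  simpa [IsCAT0.mix] using (hX.geodesic x y).choose_spec.2.1

theorem IsCAT0.dist_mix_mix_self (hX : IsCAT0 X) (x y : X) {s t : ℝ} (hs : s ∈ Icc (0 : ℝ) 1)
    (ht : t ∈ Icc (0 : ℝ) 1) : dist (hX.mix x y s) (hX.mix x y t) = |s - t| * dist x y := by
  rw [IsCAT0.mix, IsCAT0.mix, (hX.geodesic x y).choose_spec.2.2 _ (mul_dist_mem_Icc x y hs) _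
    (mul_dist_mem_Icc x y ht), ← sub_mul, abs_mul, abs_of_nonneg (dist_nonneg (x := x) (y := y))]

theorem IsCAT0.dist_left_mix (hX : IsCAT0 X) (x y : X) {s : ℝ} (hs : s ∈ Icc (0 : ℝ) 1) :
    dist x (hX.mix x y s) = s * dist x y := by
  have := hX.dist_mix_mix_self x y (s := 0) (t := s) ⟨le_rfl, zero_le_one⟩ hs
  rwa [hX.mix_zero, zero_sub, abs_neg, abs_of_nonneg hs.1] at this

theorem IsCAT0.dist_mix_right (hX : IsCAT0 X) (x y : X) {s : ℝ} (hs : s ∈ Icc (0 : ℝ) 1) :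
    dist (hX.mix x y s) y = (1 - s) * dist x y := by
  have := hX.dist_mix_mix_self x y (s := s) (t := 1) hs ⟨zero_le_one, le_rfl⟩
  rwa [hX.mix_one, abs_sub_comm, abs_of_nonneg (by linarith [hs.2])] at this

theorem IsCAT0.cn_mix (hX : IsCAT0 X) (x y p : X) {s : ℝ} (hs : s ∈ Icc (0 : ℝ) 1) :
    dist (hX.mix x y s) p ^ 2 ≤
      (1 - s) * dist x p ^ 2 + s * dist y p ^ 2 - s * (1 - s) * dist x y ^ 2 :=
  hX.cn (hX.geodesic x y).choose_spec p hs

/-- The right side of CN vanishes for such a `p`. This is uniqueness of geodesics, and it is how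
images of segments under isometries are identified later. -/
theorem IsCAT0.eq_mix (hX : IsCAT0 X) {x y p : X} {s : ℝ} (hs : s ∈ Icc (0 : ℝ) 1)
    (h1 : dist x p = s * dist x y) (h2 : dist p y = (1 - s) * dist x y) : p = hX.mix x y s := by
  have h := hX.cn_mix x y p hs
  rw [h1, dist_comm y p, h2] at h
  have h0 : dist (hX.mix x y s) p ^ 2 ≤ 0 := h.trans_eq (by ring)
  have h3 : dist (hX.mix x y s) p = 0 := by
    apply pow_eq_zero_iff (two_ne_zero) |>.1
    exact le_antisymm h0 (sq_nonneg _)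
  exact (dist_eq_zero.1 h3).symm

theorem IsCAT0.seg_eq_mix (hX : IsCAT0 X) {γ : ℝ → X} {x y : X} (h : IsGeodesicSegment γ x y)
    {s : ℝ} (hs : s ∈ Icc (0 : ℝ) 1) : γ (s * dist x y) = hX.mix x y s := by
  have hm := mul_dist_mem_Icc x y hs
  apply hX.eq_mix hs
  · rw [← congrArg (dist · (γ (s * dist x y))) h.1]
    rw [h.2.2 0 ⟨le_rfl, dist_nonneg⟩ _ hm, zero_sub, abs_neg, abs_of_nonneg hm.1]
  · rw [← congrArg (dist (γ (s * dist x y)) ·) h.2.1]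
    rw [h.2.2 _ hm _ ⟨dist_nonneg, le_rfl⟩, abs_sub_comm, abs_of_nonneg (by linarith [hm.2])]
    ring

theorem IsCAT0.mix_symm (hX : IsCAT0 X) (x y : X) {s : ℝ} (hs : s ∈ Icc (0 : ℝ) 1) :
    hX.mix x y s = hX.mix y x (1 - s) := by
  apply hX.eq_mix ⟨by linarith [hs.2], by linarith [hs.1]⟩
  · rw [dist_comm, hX.dist_mix_right x y hs, dist_comm x y]
  · rw [dist_comm, hX.dist_left_mix x y hs, dist_comm x y]; ring

theorem IsCAT0.dist_mix_left_le (hX : IsCAT0 X) (x y z : X) {s : ℝ} (hs : s ∈ Icc (0 : ℝ) 1) :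
    dist (hX.mix x y s) (hX.mix x z s) ≤ s * dist y z := by
  have h1 := hX.cn_mix x y (hX.mix x z s) hs
  have h2 := hX.cn_mix x z y hs
  rw [hX.dist_left_mix x z hs] at h1
  rw [dist_comm _ y, dist_comm z y] at h2
  have h3 := mul_le_mul_of_nonneg_left h2 hs.1
  apply le_of_sq_le_sq _ (mul_nonneg hs.1 dist_nonneg)
  nlinarith

/-- Cut the quadrilateral along the diagonal from `x` to `y'` and use the one-vertex case in both
triangles. -/
theorem IsCAT0.dist_mix_le (hX : IsCAT0 X) (x y x' y' : X) {s : ℝ} (hs : s ∈ Icc (0 : ℝ) 1) :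
    dist (hX.mix x y s) (hX.mix x' y' s) ≤ (1 - s) * dist x x' + s * dist y y' := by
  have hs' : 1 - s ∈ Icc (0 : ℝ) 1 := ⟨by linarith [hs.2], by linarith [hs.1]⟩
  have h1 := hX.dist_mix_left_le x y y' hs
  have h2 := hX.dist_mix_left_le y' x x' hs'
  rw [← hX.mix_symm x y' hs, ← hX.mix_symm x' y' hs] at h2
  linarith [dist_triangle (hX.mix x y s) (hX.mix x y' s) (hX.mix x' y' s)]

theorem IsCAT0.isGeodConvex_iff (hX : IsCAT0 X) {C : Set X} :
    IsGeodConvex C ↔ ∀ x ∈ C, ∀ y ∈ C, ∀ s ∈ Icc (0 : ℝ) 1, hX.mix x y s ∈ C := by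
  constructor
  · intro h x hx y hy s hs
    exact h x hx y hy _ (hX.geodesic x y).choose_spec _ (mul_dist_mem_Icc x y hs)
  · intro h x hx y hy γ hγ t ht
    rcases (dist_nonneg (x := x) (y := y)).eq_or_lt with h0 | h0
    · rw [← h0] at ht
      rw [le_antisymm ht.2 ht.1, hγ.1]
      exact hx
    · have hs : t / dist x y ∈ Icc (0 : ℝ) 1 :=
        ⟨div_nonneg ht.1 h0.le, (div_le_one h0).2 ht.2⟩
      have := h x hx y hy _ hs
      rwa [← hX.seg_eq_mix hγ hs, div_mul_cancel₀ _ h0.ne'] at this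

/-- The quadrilateral inequality. -/
theorem IsCAT0.quadrilateral (hX : IsCAT0 X) (a b c d : X) :
    dist a c ^ 2 + dist b d ^ 2 ≤ dist a b ^ 2 + dist b c ^ 2 + dist c d ^ 2 + dist d a ^ 2 := by
  have hs : (1 / 2 : ℝ) ∈ Icc (0 : ℝ) 1 := by constructor <;> norm_num
  have h1 := hX.cn_mix a c b hs
  have h2 := hX.cn_mix a c d hs
  have h3 := dist_triangle_left b d (hX.mix a c (1 / 2))
  have h4 := pow_le_pow_left₀ dist_nonneg h3 2
  rw [dist_comm c b] at h1
  rw [dist_comm a d] at h2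
  nlinarith [sq_nonneg (dist (hX.mix a c (1 / 2)) b - dist (hX.mix a c (1 / 2)) d)]

theorem IsClosedConvex.mix_mem {C : Set X} (hC : IsClosedConvex C) (hX : IsCAT0 X) {x y : X}
    (hx : x ∈ C) (hy : y ∈ C) {s : ℝ} (hs : s ∈ Icc (0 : ℝ) 1) : hX.mix x y s ∈ C :=
  hX.isGeodConvex_iff.1 hC.convex x hx y hy s hs

/-- The angle at a closest point is at least a right angle. -/
theorem IsClosedConvex.sq_add_sq_le {C : Set X} (hC : IsClosedConvex C) (hX : IsCAT0 X) {x p c : X}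
    (hp : p ∈ C) (hpx : ∀ c ∈ C, dist x p ≤ dist x c) (hc : c ∈ C) :
    dist x p ^ 2 + dist p c ^ 2 ≤ dist x c ^ 2 := by
  have key : ∀ s ∈ Ioc (0 : ℝ) 1, dist x p ^ 2 + (1 - s) * dist p c ^ 2 ≤ dist x c ^ 2 := by
    intro s hs
    have hs' : s ∈ Icc (0 : ℝ) 1 := ⟨hs.1.le, hs.2⟩
    have h1 := hX.cn_mix p c x hs'
    have h2 := pow_le_pow_left₀ dist_nonneg (hpx _ (hC.mix_mem hX hp hc hs')) 2
    rw [dist_comm _ x, dist_comm p x, dist_comm c x] at h1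
    have h3 : s * (dist x p ^ 2 + (1 - s) * dist p c ^ 2) ≤ s * dist x c ^ 2 := by nlinarith
    exact le_of_mul_le_mul_left h3 hs.1
  by_contra! h
  have hpos : 0 < dist p c ^ 2 := by
    have := key 1 ⟨zero_lt_one, le_rfl⟩
    nlinarith [sq_nonneg (dist p c)]
  set e := dist x p ^ 2 + dist p c ^ 2 - dist x c ^ 2 with he
  -- This parameter makes the error term `s * dist p c ^ 2` at most half of the supposed defect `e`.
  have h2 := key (min 1 (e / (2 * dist p c ^ 2)))
    ⟨lt_min zero_lt_one (div_pos (by linarith) (by linarith)), min_le_left _ _⟩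
  have h3 : min 1 (e / (2 * dist p c ^ 2)) * dist p c ^ 2 ≤ e / 2 := by
    calc _ ≤ e / (2 * dist p c ^ 2) * dist p c ^ 2 := by gcongr; exact min_le_right _ _
      _ = e / 2 := by rw [div_mul_eq_mul_div, mul_div_mul_right _ _ hpos.ne']
  nlinarith

section Proj

variable [ProperSpace X] {C : Set X}

theorem IsClosedConvex.proj_spec (hC : IsClosedConvex C) (x : X) :
    proj C x ∈ C ∧ ∀ c ∈ C, dist x (proj C x) ≤ dist x c := by
  have h : ∃ p ∈ C, ∀ c ∈ C, dist x p ≤ dist x c := by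
    obtain ⟨p, hp, h⟩ := hC.closed.exists_infDist_eq_dist hC.nonempty x
    exact ⟨p, hp, fun c hc => h ▸ Metric.infDist_le_dist_of_mem hc⟩
  rw [proj, dif_pos h]
  exact h.choose_spec

theorem IsClosedConvex.proj_mem (hC : IsClosedConvex C) (x : X) : proj C x ∈ C :=
  (hC.proj_spec x).1

theorem IsClosedConvex.infDist_eq (hC : IsClosedConvex C) (x : X) :
    Metric.infDist x C = dist x (proj C x) := by
  apply le_antisymm (Metric.infDist_le_dist_of_mem (hC.proj_mem x))
  exact (Metric.le_infDist hC.nonempty).2 fun {c} hc => (hC.proj_spec x).2 c hc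

theorem IsClosedConvex.eq_proj (hC : IsClosedConvex C) (hX : IsCAT0 X) {x p : X}
    (hp : p ∈ C) (hpx : ∀ c ∈ C, dist x p ≤ dist x c) : p = proj C x := by
  have h1 := hC.sq_add_sq_le hX hp hpx (hC.proj_mem x)
  have h2 := pow_le_pow_left₀ dist_nonneg ((hC.proj_spec x).2 p hp) 2
  have h3 : dist p (proj C x) ^ 2 = 0 := le_antisymm (by linarith) (sq_nonneg _)
  exact dist_eq_zero.1 ((pow_eq_zero_iff two_ne_zero).1 h3)

end Proj

/-- Convexity along geodesic segments of a real function on a subset. -/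
def GeodConvexFun (hX : IsCAT0 X) (C : Set X) (f : X → ℝ) : Prop :=
  ∀ x ∈ C, ∀ y ∈ C, ∀ s ∈ Icc (0 : ℝ) 1, f (hX.mix x y s) ≤ (1 - s) * f x + s * f y

theorem IsClosedConvex.infDist_convex [ProperSpace X] {C : Set X} (hC : IsClosedConvex C)
    (hX : IsCAT0 X) (S : Set X) : GeodConvexFun hX S (fun x => Metric.infDist x C) := by
  intro x _ y _ s hs
  simp only [hC.infDist_eq x, hC.infDist_eq y]
  exact (Metric.infDist_le_dist_of_mem (hC.mix_mem hX (hC.proj_mem x) (hC.proj_mem y) hs)).trans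
    (hX.dist_mix_le _ _ _ _ hs)

theorem IsClosedConvex.sublevel {hX : IsCAT0 X} {C : Set X} (hC : IsClosedConvex C) {f : X → ℝ}
    (hf : ContinuousOn f C) (hconv : GeodConvexFun hX C f) {c : ℝ} {x : X} (hx : x ∈ C)
    (hxc : f x ≤ c) : IsClosedConvex {x ∈ C | f x ≤ c} where
  nonempty := ⟨x, hx, hxc⟩
  closed := hf.preimage_isClosed_of_isClosed hC.closed (isClosed_Iic (a := c))
  convex := by
    rw [hX.isGeodConvex_iff]
    intro x hx y hy s hs
    refine ⟨hC.mix_mem hX hx.1 hy.1 hs, (hconv x hx.1 y hy.1 s hs).trans ?_⟩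
    nlinarith [hx.2, hy.2, hs.1, hs.2]

end Basics

/-! ### Geodesic rays, boundaries of convex sets, and parallelism. -/

section Rays

open Filter

universe u

variable {X : Type u} [MetricSpace X]

/-- The point at distance `t` from `x` on the geodesic segment from `x` to `y`, or `y` if
`dist x y < t`. -/
noncomputable def IsCAT0.along (hX : IsCAT0 X) (x y : X) (t : ℝ) : X :=
  hX.mix x y (min 1 (t / dist x y))

theorem min_div_mem {t d : ℝ} (ht : 0 ≤ t) (hd : 0 ≤ d) : min 1 (t / d) ∈ Icc (0 : ℝ) 1 :=
  ⟨le_min zero_le_one (div_nonneg ht hd), min_le_left _ _⟩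

theorem IsClosedConvex.along_mem {C : Set X} (hC : IsClosedConvex C) (hX : IsCAT0 X) {x y : X}
    (hx : x ∈ C) (hy : y ∈ C) {t : ℝ} (ht : 0 ≤ t) : hX.along x y t ∈ C :=
  hC.mix_mem hX hx hy (min_div_mem ht dist_nonneg)

theorem IsCAT0.along_zero (hX : IsCAT0 X) (x y : X) : hX.along x y 0 = x := by
  simp [IsCAT0.along, hX.mix_zero]

theorem min_div_mul {t d : ℝ} (ht : 0 ≤ t) (htd : t ≤ d) : min 1 (t / d) * d = t := by
  rcases (ht.trans htd).eq_or_lt with h | h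
  · subst h; simp [le_antisymm htd ht]
  · rw [min_eq_right ((div_le_one h).2 htd), div_mul_cancel₀ _ h.ne']

theorem IsCAT0.dist_left_along_le (hX : IsCAT0 X) (x y : X) {t : ℝ} (ht : 0 ≤ t) :
    dist x (hX.along x y t) ≤ t := by
  rw [IsCAT0.along, hX.dist_left_mix x y (min_div_mem ht dist_nonneg)]
  rcases (dist_nonneg (x := x) (y := y)).eq_or_lt with h | h
  · rw [← h]; simpa using ht
  · calc _ ≤ t / dist x y * dist x y := by gcongr; exact min_le_right _ _
      _ = t := div_mul_cancel₀ _ h.ne'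

theorem IsCAT0.dist_along_along (hX : IsCAT0 X) (x y : X) {s t : ℝ}
    (hs : s ∈ Icc (0 : ℝ) (dist x y)) (ht : t ∈ Icc (0 : ℝ) (dist x y)) :
    dist (hX.along x y s) (hX.along x y t) = |s - t| := by
  rw [IsCAT0.along, IsCAT0.along, hX.dist_mix_mix_self x y (min_div_mem hs.1 dist_nonneg)
    (min_div_mem ht.1 dist_nonneg), ← abs_of_nonneg (dist_nonneg (x := x) (y := y)), ← abs_mul,
    sub_mul, abs_of_nonneg (dist_nonneg (x := x) (y := y)), min_div_mul hs.1 hs.2,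
    min_div_mul ht.1 ht.2]

theorem IsCAT0.dist_along_right (hX : IsCAT0 X) (x y : X) {t : ℝ}
    (ht : t ∈ Icc (0 : ℝ) (dist x y)) : dist (hX.along x y t) y = dist x y - t := by
  rw [IsCAT0.along, hX.dist_mix_right x y (min_div_mem ht.1 dist_nonneg), sub_mul, one_mul,
    min_div_mul ht.1 ht.2]

theorem IsCAT0.seg_eq_along (hX : IsCAT0 X) {γ : ℝ → X} {x y : X} (h : IsGeodesicSegment γ x y)
    {t : ℝ} (ht : t ∈ Icc (0 : ℝ) (dist x y)) : γ t = hX.along x y t := by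
  rw [IsCAT0.along, ← hX.seg_eq_mix h (min_div_mem ht.1 dist_nonneg), min_div_mul ht.1 ht.2]

theorem IsCAT0.isGeodesicSegment_along (hX : IsCAT0 X) (x y : X) :
    IsGeodesicSegment (hX.along x y) x y := by
  refine ⟨hX.along_zero x y, ?_, fun s hs t ht => hX.dist_along_along x y hs ht⟩
  apply dist_eq_zero.1
  rw [hX.dist_along_right x y ⟨dist_nonneg, le_rfl⟩, sub_self]

/-- Compare first at equal ratios, then correct the ratio. The factor `t / dist x y` is kept because
it tends to zero for distant endpoints, which gives convergence in the cone topology. -/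
theorem IsCAT0.dist_along_le (hX : IsCAT0 X) (x y x' y' : X) {t : ℝ} (ht : 0 ≤ t)
    (h : t ≤ dist x y) (h' : t ≤ dist x' y') :
    dist (hX.along x y t) (hX.along x' y' t) ≤
      dist x x' + 2 * (min 1 (t / dist x y) * dist y y') := by
  have hs := min_div_mem ht (dist_nonneg (x := x) (y := y))
  have hs' := min_div_mem ht (dist_nonneg (x := x') (y := y'))
  have hd := min_div_mul ht h
  have hd' := min_div_mul ht h'
  unfold IsCAT0.along
  set s := min 1 (t / dist x y)
  set s' := min 1 (t / dist x' y')
  have h1 := hX.dist_mix_le x y x' y' hs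
  have h2 := hX.dist_mix_mix_self x' y' hs hs'
  have h3 : |s - s'| * dist x' y' ≤ s * (dist x x' + dist y y') := by
    have h4 : |s - s'| * dist x' y' = s * |dist x' y' - dist x y| := by
      conv_lhs => rw [← abs_of_nonneg (dist_nonneg (x := x') (y := y'))]
      rw [← abs_mul, sub_mul, hd', ← hd, ← mul_sub, abs_mul, abs_of_nonneg hs.1]
    rw [h4]
    apply mul_le_mul_of_nonneg_left _ hs.1
    rw [abs_le]
    constructor
    · linarith [dist_triangle4 x x' y' y, dist_comm y y']
    · linarith [dist_triangle4 x' x y y', dist_comm x x']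
  linarith [dist_triangle (hX.mix x y s) (hX.mix x' y' s) (hX.mix x' y' s')]

theorem GeodesicRay.dist_eq (α : GeodesicRay X) (s t : ℝ≥0) :
    dist (α.toFun s) (α.toFun t) = |(s : ℝ) - t| := by
  rw [α.isometry.dist_eq, NNReal.dist_eq]

theorem GeodesicRay.dist_zero (α : GeodesicRay X) (t : ℝ≥0) :
    dist (α.toFun 0) (α.toFun t) = t := by
  rw [α.dist_eq, NNReal.coe_zero, zero_sub, abs_neg, NNReal.abs_eq]

theorem GeodesicRay.mul_eq_mix (α : GeodesicRay X) (hX : IsCAT0 X) (s T : ℝ≥0) (hs : s ≤ 1) :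
    α.toFun (s * T) = hX.mix (α.toFun 0) (α.toFun T) s := by
  apply hX.eq_mix ⟨s.coe_nonneg, by exact_mod_cast hs⟩
  · rw [α.dist_zero, α.dist_zero]; exact NNReal.coe_mul s T
  · rw [α.dist_zero, α.dist_eq, abs_sub_comm]
    have : (s : ℝ) ≤ 1 := by exact_mod_cast hs
    have hT : (0 : ℝ) ≤ T := T.coe_nonneg
    rw [NNReal.coe_mul, abs_of_nonneg] <;> nlinarith

theorem GeodesicRay.eq_along (α : GeodesicRay X) (hX : IsCAT0 X) {t T : ℝ≥0} (h : t ≤ T) :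
    α.toFun t = hX.along (α.toFun 0) (α.toFun T) t := by
  have hm := min_div_mem t.coe_nonneg T.coe_nonneg
  set s : ℝ≥0 := ⟨_, hm.1⟩
  have h1 := α.mul_eq_mix hX s T hm.2
  have h2 : s * T = t := by
    ext
    exact min_div_mul t.coe_nonneg (by exact_mod_cast h)
  rw [h2] at h1
  rw [h1, IsCAT0.along, α.dist_zero]
  rfl

/-- Convexity on `[0, (n + 1) t]` bounds `g t - g 0` by `(K - g 0) / (n + 1)`, for every `n`. -/
theorem le_of_convex_of_bounded {g : ℝ≥0 → ℝ} {K : ℝ}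
    (hg : ∀ s T : ℝ≥0, s ≤ 1 → g (s * T) ≤ (1 - s) * g 0 + s * g T) (hK : ∀ t, g t ≤ K)
    (t : ℝ≥0) : g t ≤ g 0 := by
  rcases eq_or_ne t 0 with rfl | ht
  · rfl
  by_contra! h
  obtain ⟨n, hn⟩ := exists_nat_gt ((K - g 0) / (g t - g 0))
  have hn1 : (K - g 0) < n * (g t - g 0) := (div_lt_iff₀ (by linarith)).1 hn
  have hn2 : (1 : ℝ) ≤ n + 1 := by linarith [n.cast_nonneg (α := ℝ)]
  have h1 := hg ((n + 1 : ℝ≥0)⁻¹) ((n + 1) * t) (inv_le_one_of_one_le₀ (by exact_mod_cast hn2))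
  rw [← mul_assoc, inv_mul_cancel₀ (by positivity), one_mul] at h1
  have h2 := hK ((n + 1) * t)
  push_cast at h1
  have hpos : (0 : ℝ) < n + 1 := by linarith
  have h3 : ((n : ℝ) + 1) * g t ≤ n * g 0 + g ((n + 1) * t) := by
    calc _ ≤ ((n : ℝ) + 1) * ((1 - ((n : ℝ) + 1)⁻¹) * g 0 + ((n : ℝ) + 1)⁻¹ * g ((n + 1) * t)) := by
          gcongr
      _ = _ := by field_simp; ring
  nlinarith

theorem GeodConvexFun.ray_le {hX : IsCAT0 X} {C : Set X} {f : X → ℝ} (hf : GeodConvexFun hX C f)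
    (α : GeodesicRay X) (hα : ∀ t, α.toFun t ∈ C) {K : ℝ} (hK : ∀ t, f (α.toFun t) ≤ K)
    (t : ℝ≥0) : f (α.toFun t) ≤ f (α.toFun 0) := by
  refine le_of_convex_of_bounded (g := fun t => f (α.toFun t)) (fun s T hs => ?_) hK t
  rw [α.mul_eq_mix hX s T hs]
  exact hf _ (hα 0) _ (hα T) s ⟨s.coe_nonneg, by exact_mod_cast hs⟩

theorem IsCAT0.dist_ray_le (hX : IsCAT0 X) {α β : GeodesicRay X} {K : ℝ}
    (hK : ∀ t, dist (α.toFun t) (β.toFun t) ≤ K) (t : ℝ≥0) :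
    dist (α.toFun t) (β.toFun t) ≤ dist (α.toFun 0) (β.toFun 0) := by
  refine le_of_convex_of_bounded (g := fun t => dist (α.toFun t) (β.toFun t))
    (fun s T hs => ?_) hK t
  simp only [α.mul_eq_mix hX s T hs, β.mul_eq_mix hX s T hs]
  exact hX.dist_mix_le _ _ _ _ ⟨s.coe_nonneg, by exact_mod_cast hs⟩

theorem GeodesicRay.endpoint_eq_iff {α β : GeodesicRay X} :
    α.endpoint = β.endpoint ↔ ∃ K : ℝ, ∀ t : ℝ≥0, dist (α.toFun t) (β.toFun t) ≤ K :=
  Quotient.eq (r := rayEquiv X)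

theorem boundaryOf_mono {C D : Set X} (h : C ⊆ D) : boundaryOf C ⊆ boundaryOf D := by
  rintro ξ ⟨α, hα, rfl⟩
  exact ⟨α, fun t => h (hα t), rfl⟩

variable [ProperSpace X]

/-- Segments with bounded starting points whose lengths tend to infinity accumulate at a ray. -/
theorem IsCAT0.exists_limit_ray (hX : IsCAT0 X) {p z : ℕ → X} {o : X} {R : ℝ}
    (hp : ∀ n, dist (p n) o ≤ R) (hz : Tendsto (fun n => dist (p n) (z n)) atTop atTop) :
    ∃ ρ : GeodesicRay X, ∀ t : ℝ≥0,
      Tendsto (fun n => hX.along (p n) (z n) t) (hyperfilter ℕ) (𝓝 (ρ.toFun t)) := by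
  -- A single ultrafilter gives limits at all times `t` at once, in place of a diagonal subsequence.
  have h1 : ∀ t : ℝ≥0, ∃ x, Tendsto (fun n => hX.along (p n) (z n) t) (hyperfilter ℕ) (𝓝 x) := by
    intro t
    obtain ⟨x, -, hx⟩ := (isCompact_closedBall o (R + t)).ultrafilter_le_nhds
      ((hyperfilter ℕ).map fun n => hX.along (p n) (z n) t) (by
        rw [le_principal_iff]
        refine Filter.mem_map.2 (Filter.mem_of_superset univ_mem fun n _ => ?_)
        rw [mem_preimage, Metric.mem_closedBall]
        linarith [dist_triangle_left (hX.along (p n) (z n) t) o (p n), hp n,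
          hX.dist_left_along_le (p n) (z n) t.coe_nonneg])
    exact ⟨x, hx⟩
  choose ρ hρ using h1
  refine ⟨⟨ρ, Isometry.of_dist_eq fun s t => ?_⟩, hρ⟩
  refine tendsto_nhds_unique ((hρ s).dist (hρ t)) (tendsto_const_nhds.congr' ?_)
  have h2 := ((tendsto_atTop.1 hz s).and (tendsto_atTop.1 hz t)).filter_mono
    (Nat.hyperfilter_le_atTop)
  filter_upwards [h2] with n hn
  exact (NNReal.dist_eq s t).trans (hX.dist_along_along _ _ ⟨s.coe_nonneg, hn.1⟩ ⟨t.coe_nonneg, hn.2⟩).symm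

/-- A closed convex set that stays at bounded distance from a ray contains, from each of its points,
a ray asymptotic to it. -/
theorem IsClosedConvex.exists_ray {C : Set X} (hC : IsClosedConvex C) (hX : IsCAT0 X)
    (α : GeodesicRay X) {R : ℝ} (hR : ∀ n : ℕ, ∃ q ∈ C, dist q (α.toFun n) ≤ R) {p : X}
    (hp : p ∈ C) : ∃ β : GeodesicRay X, β.toFun 0 = p ∧ (∀ t, β.toFun t ∈ C) ∧
      β.endpoint = α.endpoint := by
  choose q hqC hq using hR
  have hd : ∀ n : ℕ, (n : ℝ) - (R + dist p (α.toFun 0)) ≤ dist p (q n) := fun n => by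
    have h1 := α.dist_zero n
    rw [NNReal.coe_natCast] at h1
    linarith [dist_triangle4 (α.toFun 0) p (q n) (α.toFun n), hq n, dist_comm p (α.toFun 0)]
  have hz : Tendsto (fun n => dist p (q n)) atTop atTop :=
    tendsto_atTop_mono hd (tendsto_atTop_add_const_right _ _ tendsto_natCast_atTop_atTop)
  obtain ⟨β, hβ⟩ := hX.exists_limit_ray (p := fun _ => p) (o := p) (R := 0) (by simp) hz
  refine ⟨β, ?_, fun t => ?_, GeodesicRay.endpoint_eq_iff.2
    ⟨dist p (α.toFun 0) + 2 * R, fun t => ?_⟩⟩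
  · refine tendsto_nhds_unique (hβ 0) ?_
    simp only [NNReal.coe_zero, hX.along_zero]
    exact tendsto_const_nhds
  · exact hC.closed.mem_of_tendsto (hβ t)
      (Eventually.of_forall fun n => hC.along_mem hX hp (hqC n) t.coe_nonneg)
  · refine le_of_tendsto ((hβ t).dist tendsto_const_nhds) ?_
    have h2 := ((tendsto_atTop.1 hz t).and (eventually_ge_atTop ⌈t⌉₊)).filter_mono
      (Nat.hyperfilter_le_atTop)
    filter_upwards [h2] with n hn
    have hn2 : t ≤ (n : ℝ≥0) := Nat.ceil_le.1 hn.2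
    rw [α.eq_along hX hn2]
    refine (hX.dist_along_le _ _ _ _ t.coe_nonneg hn.1 ?_).trans ?_
    · rw [α.dist_zero]; exact_mod_cast hn2
    · have hs := min_div_mem t.coe_nonneg (dist_nonneg (x := p) (y := q n))
      have := mul_le_of_le_one_left (dist_nonneg (x := q n) (y := α.toFun n)) hs.2
      linarith [hq n]

theorem IsClosedConvex.exists_ray_of_mem_boundary {C : Set X} (hC : IsClosedConvex C)
    (hX : IsCAT0 X) {ξ : Boundary X} (hξ : ξ ∈ boundaryOf C) {p : X} (hp : p ∈ C) :
    ∃ β : GeodesicRay X, β.toFun 0 = p ∧ (∀ t, β.toFun t ∈ C) ∧ β.endpoint = ξ := by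
  obtain ⟨α, hα, rfl⟩ := hξ
  exact hC.exists_ray hX α (R := 0) (fun n => ⟨_, hα n, by simp⟩) hp

theorem IsClosedConvex.boundaryOf_subset {C : Set X} (hC : IsClosedConvex C) (hX : IsCAT0 X)
    {D : Set X} {R : ℝ} (h : ∀ y ∈ D, Metric.infDist y C ≤ R) : boundaryOf D ⊆ boundaryOf C := by
  rintro ξ ⟨α, hα, rfl⟩
  obtain ⟨p, hp⟩ := hC.nonempty
  obtain ⟨β, -, hβ, h2⟩ := hC.exists_ray hX α (R := R) (fun n =>
    ⟨_, hC.proj_mem (α.toFun n), by rw [dist_comm, ← hC.infDist_eq]; exact h _ (hα n)⟩) hp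
  exact ⟨β, hβ, h2⟩

/-- A convex function that is bounded on the rays of a boundary minimal set is constant on it. -/
theorem IsBoundaryMinimal.eq_of_convex {C : Set X} (hC : IsBoundaryMinimal C) {hX : IsCAT0 X}
    {f : X → ℝ} (hf : ContinuousOn f C) (hconv : GeodConvexFun hX C f)
    (hbdd : ∀ α : GeodesicRay X, (∀ t, α.toFun t ∈ C) → ∃ K, ∀ t, f (α.toFun t) ≤ K)
    {x y : X} (hx : x ∈ C) (hy : y ∈ C) : f x = f y := by
  have key : ∀ x ∈ C, ∀ y ∈ C, f y ≤ f x := by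
    intro x hx y hy
    have hB := hC.1.sublevel hf hconv hx le_rfl
    have := hC.2 _ hB (fun z hz => hz.1) (by
      apply (boundaryOf_mono fun z hz => hz.1).antisymm
      intro ξ hξ
      obtain ⟨β, h0, hβ, hξ⟩ := hC.1.exists_ray_of_mem_boundary hX hξ hx
      obtain ⟨K, hK⟩ := hbdd β hβ
      exact ⟨β, fun t => ⟨hβ t, h0 ▸ hconv.ray_le β hβ hK t⟩, hξ⟩)
    rw [← this] at hy
    exact hy.2
  exact le_antisymm (key y hy x hx) (key x hx y hy)

/-- Every ray in `A` is asymptotic to one in `B`, so the convex function `infDist · B` is bounded on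
it. -/
theorem IsBoundaryMinimal.infDist_eq {A B : Set X} (hA : IsBoundaryMinimal A) (hX : IsCAT0 X)
    (hB : IsClosedConvex B) (h : boundaryOf A ⊆ boundaryOf B) {x y : X} (hx : x ∈ A) (hy : y ∈ A) :
    Metric.infDist x B = Metric.infDist y B := by
  refine hA.eq_of_convex (Metric.continuous_infDist_pt B).continuousOn (hB.infDist_convex hX A)
    (fun α hα => ?_) hx hy
  obtain ⟨β, hβ, hβα⟩ := h ⟨α, hα, rfl⟩
  obtain ⟨K, hK⟩ := GeodesicRay.endpoint_eq_iff.1 hβα.symm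
  exact ⟨K, fun t => (Metric.infDist_le_dist_of_mem (hβ t)).trans (hK t)⟩

/-- By equidistance no point of `A` is closer to `proj B x` than `x` is, and closest points are
unique. -/
theorem IsBoundaryMinimal.proj_proj {A B : Set X} (hA : IsBoundaryMinimal A)
    (hB : IsBoundaryMinimal B) (hX : IsCAT0 X) (h : boundaryOf A = boundaryOf B) {x : X}
    (hx : x ∈ A) : proj A (proj B x) = x := by
  symm
  apply hA.1.eq_proj hX hx
  intro c hc
  calc dist (proj B x) x = Metric.infDist x B := by rw [hB.1.infDist_eq, dist_comm]
    _ = Metric.infDist (proj A (proj B x)) B :=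
      hA.infDist_eq hX hB.1 h.subset hx (hA.1.proj_mem _)
    _ ≤ dist (proj A (proj B x)) (proj B x) :=
      Metric.infDist_le_dist_of_mem (hB.1.proj_mem _)
    _ = dist (proj B x) (proj A (proj B x)) := dist_comm _ _
    _ ≤ dist (proj B x) c := (hA.1.proj_spec _).2 c hc

theorem IsBoundaryMinimal.parallel {A B : Set X} (hA : IsBoundaryMinimal A)
    (hB : IsBoundaryMinimal B) (hX : IsCAT0 X) (h : boundaryOf A = boundaryOf B) : Parallel A B :=
  ⟨fun _ hx => hA.proj_proj hB hX h hx, fun _ hx => hB.proj_proj hA hX h.symm hx⟩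

end Rays

/-! ### Flat rectangles between parallel sets, and absence of holonomy. -/

section Translations

universe u

variable {X : Type u} [MetricSpace X] [ProperSpace X]

/-- The angles at all four corners are at least right, and the quadrilateral inequality then forces
equality throughout: the corners have the distances of a Euclidean rectangle. -/
theorem IsBoundaryMinimal.dist_proj_proj {A B : Set X} (hA : IsBoundaryMinimal A)
    (hB : IsBoundaryMinimal B) (hX : IsCAT0 X) (h : boundaryOf A = boundaryOf B) {x y : X}
    (hx : x ∈ A) (hy : y ∈ A) :
    dist (proj B x) (proj B y) = dist x y ∧
      dist x (proj B y) ^ 2 = Metric.infDist x B ^ 2 + dist x y ^ 2 := by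
  have hpA : ∀ z ∈ A, ∀ c ∈ A, dist (proj B z) z ≤ dist (proj B z) c := fun z hz c hc => by
    have := (hA.1.proj_spec (proj B z)).2 c hc
    rwa [hA.proj_proj hB hX h hz] at this
  have h1 := hB.1.sq_add_sq_le hX (hB.1.proj_mem x) (hB.1.proj_spec x).2 (hB.1.proj_mem y)
  have h2 := hB.1.sq_add_sq_le hX (hB.1.proj_mem y) (hB.1.proj_spec y).2 (hB.1.proj_mem x)
  have h3 := hA.1.sq_add_sq_le hX hx (hpA x hx) hy
  have h4 := hA.1.sq_add_sq_le hX hy (hpA y hy) hx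
  have h5 := hX.quadrilateral x (proj B x) (proj B y) y
  have h6 := hA.infDist_eq hX hB.1 h.subset hx hy
  rw [hB.1.infDist_eq, hB.1.infDist_eq] at h6
  rw [hB.1.infDist_eq]
  simp only [dist_comm (proj B y) y, dist_comm y x, dist_comm (proj B y) x,
    dist_comm (proj B y) (proj B x), dist_comm (proj B x) x, dist_comm (proj B x) y, ← h6]
    at h1 h2 h3 h4 h5
  constructor
  · refine (sq_eq_sq₀ dist_nonneg dist_nonneg).1 ?_
    linarith
  · linarith

theorem IsBoundaryMinimal.dist_eq_of_isometric {A : Set X} (hA : IsBoundaryMinimal A)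
    (hX : IsCAT0 X) {φ : X → X}
    (hiso : ∀ x ∈ A, ∀ y ∈ A, dist (φ x) (φ y) = dist x y) {K : ℝ}
    (hK : ∀ x ∈ A, dist x (φ x) ≤ K) {x y : X} (hx : x ∈ A) (hy : y ∈ A) :
    dist x (φ x) = dist y (φ y) := by
  refine hA.eq_of_convex (hX := hX) (f := fun x => dist x (φ x)) ?_ ?_
    (fun α hα => ⟨K, fun t => hK _ (hα t)⟩) hx hy
  · refine continuous_dist.comp_continuousOn (continuousOn_id.prodMk ?_)
    have : LipschitzOnWith 1 φ A := LipschitzOnWith.of_dist_le_mul fun x hx y hy => by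
      simp [hiso x hx y hy]
    exact this.continuousOn
  · intro x hx y hy s hs
    have hm := hA.1.mix_mem hX hx hy hs
    have : φ (hX.mix x y s) = hX.mix (φ x) (φ y) s := by
      apply hX.eq_mix hs
      · rw [hiso _ hx _ hm, hiso _ hx _ hy, hX.dist_left_mix x y hs]
      · rw [hiso _ hm _ hy, hiso _ hx _ hy, hX.dist_mix_right x y hs]
    simp only [this]
    exact hX.dist_mix_le _ _ _ _ hs

/-- The midpoint of `x, φ x` goes to that of `φ x, φ (φ x)`. These midpoints are at most half of
`dist x (φ (φ x))` apart, yet the displacement is constant. -/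
theorem IsBoundaryMinimal.two_mul_dist_le {A : Set X} (hA : IsBoundaryMinimal A)
    (hX : IsCAT0 X) {φ : X → X} (hφ : MapsTo φ A A)
    (hiso : ∀ x ∈ A, ∀ y ∈ A, dist (φ x) (φ y) = dist x y) {K : ℝ}
    (hK : ∀ x ∈ A, dist x (φ x) ≤ K) {x : X} (hx : x ∈ A) :
    2 * dist x (φ x) ≤ dist x (φ (φ x)) := by
  have hs : (1 / 2 : ℝ) ∈ Icc (0 : ℝ) 1 := by constructor <;> norm_num
  have hm := hA.1.mix_mem hX hx (hφ hx) hs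
  have h1 : φ (hX.mix x (φ x) (1 / 2)) = hX.mix (φ x) (φ (φ x)) (1 / 2) := by
    apply hX.eq_mix hs
    · rw [hiso _ hx _ hm, hiso _ hx _ (hφ hx), hX.dist_left_mix _ _ hs]
    · rw [hiso _ hm _ (hφ hx), hiso _ hx _ (hφ hx), hX.dist_mix_right _ _ hs]
  have h2 := hA.dist_eq_of_isometric hX hiso hK hx hm
  rw [h1, hX.mix_symm x (φ x) hs, show (1 - 1 / 2 : ℝ) = 1 / 2 by norm_num] at h2
  have h3 := hX.dist_mix_left_le (φ x) x (φ (φ x)) hs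
  linarith

/-- An isometry of bounded displacement of a boundary minimal set is a translation along the orbit
of each point. -/
theorem IsBoundaryMinimal.dist_iterate {A : Set X} (hA : IsBoundaryMinimal A)
    (hX : IsCAT0 X) {φ : X → X} (hφ : MapsTo φ A A)
    (hiso : ∀ x ∈ A, ∀ y ∈ A, dist (φ x) (φ y) = dist x y) {K : ℝ}
    (hK : ∀ x ∈ A, dist x (φ x) ≤ K) (n : ℕ) {x : X} (hx : x ∈ A) :
    dist x (φ^[n] x) = n * dist x (φ x) := by
  have hle : ∀ n : ℕ, ∀ x ∈ A, dist x (φ^[n] x) ≤ n * dist x (φ x) := by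
    intro n
    induction n with
    | zero => simp
    | succ n ih =>
      intro x hx
      have h1 := ih (φ x) (hφ hx)
      rw [hiso _ hx _ (hφ hx)] at h1
      rw [Function.iterate_succ_apply]
      push_cast
      linarith [dist_triangle x (φ x) (φ^[n] (φ x))]
  have hit : ∀ n : ℕ, ∀ x ∈ A, ∀ y ∈ A, dist (φ^[n] x) (φ^[n] y) = dist x y := by
    intro n
    induction n with
    | zero => simp
    | succ n ih =>
      intro x hx y hy
      rw [Function.iterate_succ_apply, Function.iterate_succ_apply, ih _ (hφ hx) _ (hφ hy),
        hiso _ hx _ hy]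
  have hpow : ∀ k : ℕ, ∀ x ∈ A, (2 ^ k : ℕ) * dist x (φ x) ≤ dist x (φ^[2 ^ k] x) := by
    intro k
    induction k with
    | zero => simp
    | succ k ih =>
      intro x hx
      have h1 := hA.two_mul_dist_le hX (hφ.iterate (2 ^ k)) (hit _) (K := (2 ^ k : ℕ) * K)
        (fun y hy => (hle _ y hy).trans (by gcongr; exact hK y hy)) hx
      have h2 := ih x hx
      rw [pow_succ, mul_two, Function.iterate_add_apply]
      push_cast at h2 ⊢
      linarith
  refine le_antisymm (hle n x hx) ?_
  -- From powers of two to all `n`: the remaining `2 ^ n - n` steps cover at most one displacement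
  -- each.
  have hn : n ≤ 2 ^ n := Nat.lt_two_pow_self.le
  have h1 := hpow n x hx
  have h2 := hle (2 ^ n - n) (φ^[n] x) (hφ.iterate n hx)
  rw [← Function.iterate_add_apply, Nat.sub_add_cancel hn,
    ← hA.dist_eq_of_isometric hX hiso hK hx (hφ.iterate n hx), Nat.cast_sub hn] at h2
  linarith [dist_triangle x (φ^[n] x) (φ^[2 ^ n] x)]

theorem le_add_div_of_sq_eq {d δ r : ℝ} (hr : 0 < r) (h : d ^ 2 = δ ^ 2 + r ^ 2) :
    d ≤ r + δ ^ 2 / (2 * r) := by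
  apply le_of_sq_le_sq _ (by positivity)
  have : 2 * r * (δ ^ 2 / (2 * r)) = δ ^ 2 := by field_simp
  nlinarith [sq_nonneg (δ ^ 2 / (2 * r))]

/-- The composition of the projections around a triangle of parallel boundary minimal sets has no
holonomy. -/
theorem IsBoundaryMinimal.proj_proj_proj {A B C : Set X} (hA : IsBoundaryMinimal A)
    (hB : IsBoundaryMinimal B) (hC : IsBoundaryMinimal C) (hX : IsCAT0 X)
    (hAB : boundaryOf A = boundaryOf B) (hAC : boundaryOf A = boundaryOf C) {a : X} (ha : a ∈ A) :
    proj A (proj C (proj B a)) = a := by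
  have hBC : boundaryOf B = boundaryOf C := hAB.symm.trans hAC
  set φ : X → X := fun x => proj A (proj C (proj B x)) with hφdef
  have hφ : MapsTo φ A A := fun x _ => hA.1.proj_mem _
  have hiso : ∀ x ∈ A, ∀ y ∈ A, dist (φ x) (φ y) = dist x y := fun x hx y hy => by
    simp only [φ]
    rw [(hC.dist_proj_proj hA hX hAC.symm (hC.1.proj_mem _) (hC.1.proj_mem _)).1,
      (hB.dist_proj_proj hC hX hBC (hB.1.proj_mem _) (hB.1.proj_mem _)).1,
      (hA.dist_proj_proj hB hX hAB hx hy).1]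
  set δ₁ := Metric.infDist a B
  set δ₂ := Metric.infDist (proj B a) C
  set δ₃ := Metric.infDist (proj C (proj B a)) A
  have hδ₁ : ∀ x ∈ A, Metric.infDist x B = δ₁ := fun x hx => hA.infDist_eq hX hB.1 hAB.subset hx ha
  have hδ₂ : ∀ x ∈ B, Metric.infDist x C = δ₂ := fun x hx =>
    hB.infDist_eq hX hC.1 hBC.subset hx (hB.1.proj_mem _)
  have hδ₃ : ∀ x ∈ C, Metric.infDist x A = δ₃ := fun x hx =>
    hC.infDist_eq hX hA.1 hAC.symm.subset hx (hC.1.proj_mem _)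
  have hK : ∀ x ∈ A, dist x (φ x) ≤ δ₁ + δ₂ + δ₃ := fun x hx => by
    have h1 := hδ₁ x hx
    have h2 := hδ₂ _ (hB.1.proj_mem x)
    have h3 := hδ₃ _ (hC.1.proj_mem (proj B x))
    rw [hB.1.infDist_eq] at h1
    rw [hC.1.infDist_eq] at h2
    rw [hA.1.infDist_eq] at h3
    linarith [dist_triangle4 x (proj B x) (proj C (proj B x)) (φ x)]
  have hφn : ∀ n, φ^[n] a ∈ A := fun n => hφ.iterate n ha
  set τ := dist a (φ a) with hτ
  have hd : ∀ n m : ℕ, dist (φ^[n] a) (φ^[n + m] a) = m * τ := fun n m => by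
    rw [add_comm, Function.iterate_add_apply, hA.dist_iterate hX hφ hiso hK m (hφn n),
      ← hA.dist_eq_of_isometric hX hiso hK ha (hφn n)]
  by_contra hne
  have hτ0 : 0 < τ := dist_pos.2 (Ne.symm hne)
  -- Go from `a` via `B` and `C` to `φ^[3m+1] a`, advancing `m * τ` on each leg; the extra `τ` is
  -- the holonomy itself. By Pythagoras a leg exceeds `m * τ` by at most `δᵢ ^ 2 / (2 * m * τ)`, so
  -- `τ` is bounded by the sum of these excesses.
  have key : ∀ m : ℕ, 0 < m → m * (2 * τ * τ) ≤ δ₁ ^ 2 + δ₂ ^ 2 + δ₃ ^ 2 := by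
    intro m hm
    have hr : 0 < m * τ := mul_pos (Nat.cast_pos.2 hm) hτ0
    have h1 := (hA.dist_proj_proj hB hX hAB (hφn 0) (hφn m)).2
    have h2 := (hB.dist_proj_proj hC hX hBC (hB.1.proj_mem (φ^[m] a))
      (hB.1.proj_mem (φ^[m + m] a))).2
    have h3 := (hC.dist_proj_proj hA hX hAC.symm (hC.1.proj_mem (proj B (φ^[m + m] a)))
      (hC.1.proj_mem (proj B (φ^[m + m + m] a)))).2
    rw [(hB.dist_proj_proj hC hX hBC (hB.1.proj_mem _) (hB.1.proj_mem _)).1,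
      (hA.dist_proj_proj hB hX hAB (hφn _) (hφn _)).1, hd, hδ₃ _ (hC.1.proj_mem _)] at h3
    rw [(hA.dist_proj_proj hB hX hAB (hφn _) (hφn _)).1, hd, hδ₂ _ (hB.1.proj_mem _)] at h2
    rw [hδ₁ _ (hφn 0)] at h1
    have h0 := hd 0 m
    rw [zero_add] at h0
    rw [h0] at h1
    have h4 : proj A (proj C (proj B (φ^[m + m + m] a))) = φ^[m + m + m + 1] a :=
      (Function.iterate_succ_apply' φ _ a).symm
    rw [h4] at h3
    have h5 := hd 0 (m + m + m + 1)
    rw [zero_add] at h5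
    push_cast at h5
    have h6 := dist_triangle4 (φ^[0] a) (proj B (φ^[m] a)) (proj C (proj B (φ^[m + m] a)))
      (φ^[m + m + m + 1] a)
    have h7 := le_add_div_of_sq_eq hr h1
    have h8 := le_add_div_of_sq_eq hr h2
    have h9 := le_add_div_of_sq_eq hr h3
    have h10 : τ ≤ (δ₁ ^ 2 + δ₂ ^ 2 + δ₃ ^ 2) / (2 * (m * τ)) := by
      rw [add_div, add_div]
      linarith
    rw [le_div_iff₀ (by positivity)] at h10
    linarith
  obtain ⟨m, hm⟩ := exists_nat_gt ((δ₁ ^ 2 + δ₂ ^ 2 + δ₃ ^ 2) / (2 * τ * τ))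
  have hpos : 0 < 2 * τ * τ := by positivity
  rw [div_lt_iff₀ hpos] at hm
  have := key (m + 1) m.succ_pos
  push_cast at this
  linarith

/-- The form in which trivial holonomy is used: `a` and its foot in `B` have the same foot in `C`.
-/
theorem IsBoundaryMinimal.proj_proj_eq {A B C : Set X} (hA : IsBoundaryMinimal A)
    (hB : IsBoundaryMinimal B) (hC : IsBoundaryMinimal C) (hX : IsCAT0 X)
    (hAB : boundaryOf A = boundaryOf B) (hAC : boundaryOf A = boundaryOf C) {a : X} (ha : a ∈ A) :
    proj C (proj B a) = proj C a := by
  conv_rhs => rw [← hA.proj_proj_proj hB hC hX hAB hAC ha]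
  rw [hC.proj_proj hA hX hAC.symm (hC.1.proj_mem _)]

end Translations

/-! ### Minimal invariant sets and their boundary minimality. -/

section Groups

open Filter
open scoped Pointwise

universe u

variable {X : Type u} [MetricSpace X]

theorem IsCAT0.isClosedConvex_sInter (hX : IsCAT0 X) {c : Set (Set X)}
    (hc : ∀ C ∈ c, IsClosedConvex C) (hne : (⋂₀ c).Nonempty) : IsClosedConvex (⋂₀ c) where
  nonempty := hne
  closed := isClosed_sInter fun C hC => (hc C hC).closed
  convex := hX.isGeodConvex_iff.2 fun _ hx _ hy _ hs C hC =>
    (hc C hC).mix_mem hX (hx C hC) (hy C hC) hs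

theorem sInter_inter_nonempty {c : Set (Set X)} (hc : IsChain (· ⊆ ·) c) (hne : c.Nonempty)
    {K : Set X} (hK : IsCompact K) (h : ∀ C ∈ c, IsClosed C ∧ (C ∩ K).Nonempty) :
    (⋂₀ c ∩ K).Nonempty := by
  have : Nonempty c := hne.to_subtype
  obtain ⟨x, hx⟩ := IsCompact.nonempty_iInter_of_directed_nonempty_isCompact_isClosed
    (fun C : c => (C : Set X) ∩ K) (fun C D => by
      rcases hc.total C.2 D.2 with hCD | hCD
      · exact ⟨C, Subset.rfl, inter_subset_inter_left _ hCD⟩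
      · exact ⟨D, inter_subset_inter_left _ hCD, Subset.rfl⟩)
    (fun C => (h C C.2).2) (fun C => hK.inter_left (h C C.2).1)
    (fun C => (h C C.2).1.inter hK.isClosed)
  rw [mem_iInter] at hx
  exact ⟨x, fun C hC => (hx ⟨C, hC⟩).1, (hx ⟨_, hne.some_mem⟩).2⟩

variable {Γ : Type*} [Group Γ]

theorem smul_set_eq_of_invariant {S : Type*} [MulAction Γ S] {Z : Set S}
    (hZ : ∀ g : Γ, ∀ x ∈ Z, g • x ∈ Z) (g : Γ) :
    g • Z = Z := by
  apply Subset.antisymm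
  · rintro _ ⟨x, hx, rfl⟩
    exact hZ g x hx
  · intro x hx
    exact mem_smul_set_iff_inv_smul_mem.2 (hZ g⁻¹ x hx)

variable [MulAction Γ X]

/-- Every nonempty invariant subset of `Y` meets the compact set `K`, so chains have nonempty
intersection and Zorn applies. -/
theorem IsClosedConvex.exists_minimal_invariant {Y K : Set X} (hY : IsClosedConvex Y)
    (hX : IsCAT0 X) (hinv : ∀ g : Γ, ∀ x ∈ Y, g • x ∈ Y) (hK : IsCompact K)
    (hcov : ∀ x ∈ Y, ∃ g : Γ, ∃ k ∈ K, g • k = x) :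
    ∃ Z ⊆ Y, IsClosedConvex Z ∧ (∀ g : Γ, ∀ x ∈ Z, g • x ∈ Z) ∧
      ∀ B ⊆ Z, IsClosedConvex B → (∀ g : Γ, ∀ x ∈ B, g • x ∈ B) → B = Z := by
  obtain ⟨Z, hZY, hZ⟩ := zorn_superset_nonempty
    {C | IsClosedConvex C ∧ C ⊆ Y ∧ ∀ g : Γ, ∀ x ∈ C, g • x ∈ C} (by
      intro c hcS hc hne
      have hmeet : (⋂₀ c ∩ K).Nonempty := by
        refine sInter_inter_nonempty hc hne hK fun C hC => ⟨(hcS hC).1.closed, ?_⟩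
        obtain ⟨x, hx⟩ := (hcS hC).1.nonempty
        obtain ⟨g, k, hk, rfl⟩ := hcov x ((hcS hC).2.1 hx)
        refine ⟨k, ?_, hk⟩
        simpa using (hcS hC).2.2 g⁻¹ _ hx
      refine ⟨⋂₀ c, ⟨hX.isClosedConvex_sInter (fun C hC => (hcS hC).1)
        (hmeet.mono inter_subset_left), ?_, ?_⟩, fun s hs => sInter_subset_of_mem hs⟩
      · exact (sInter_subset_of_mem hne.some_mem).trans (hcS hne.some_mem).2.1
      · exact fun g x hx C hC => (hcS hC).2.2 g x (hx C hC)) Y ⟨hY, Subset.rfl, hinv⟩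
  exact ⟨Z, hZY, hZ.prop.1, hZ.prop.2.2, fun B hBZ hB hBinv =>
    hBZ.antisymm (hZ.le_of_le ⟨hB, hBZ.trans hZY, hBinv⟩ hBZ)⟩

variable [IsIsometricSMul Γ X]

theorem IsCAT0.smul_mix (hX : IsCAT0 X) (g : Γ) (x y : X) {s : ℝ} (hs : s ∈ Icc (0 : ℝ) 1) :
    g • hX.mix x y s = hX.mix (g • x) (g • y) s := by
  apply hX.eq_mix hs
  · rw [dist_smul, dist_smul, hX.dist_left_mix x y hs]
  · rw [dist_smul, dist_smul, hX.dist_mix_right x y hs]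

theorem IsClosedConvex.smul {C : Set X} (hC : IsClosedConvex C) (hX : IsCAT0 X) (g : Γ) :
    IsClosedConvex (g • C) where
  nonempty := hC.nonempty.smul_set
  closed := hC.closed.smul g
  convex := by
    rw [hX.isGeodConvex_iff]
    rintro _ ⟨x, hx, rfl⟩ _ ⟨y, hy, rfl⟩ s hs
    exact ⟨_, hC.mix_mem hX hx hy hs, hX.smul_mix g x y hs⟩

theorem infDist_smul_set (g : Γ) (x : X) (C : Set X) :
    Metric.infDist (g • x) (g • C) = Metric.infDist x C :=
  Metric.infDist_image (isometry_smul X g)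

/-- The translate of a ray. -/
def GeodesicRay.translate (g : Γ) (α : GeodesicRay X) : GeodesicRay X :=
  ⟨fun t => g • α.toFun t, (isometry_smul X g).comp α.isometry⟩

theorem GeodesicRay.endpoint_translate {α β : GeodesicRay X} (g : Γ)
    (h : α.endpoint = β.endpoint) : (α.translate g).endpoint = (β.translate g).endpoint := by
  rw [GeodesicRay.endpoint_eq_iff] at h ⊢
  obtain ⟨K, hK⟩ := h
  exact ⟨K, fun t => (dist_smul g _ _).trans_le (hK t)⟩

theorem boundaryOf_smul_subset (g : Γ) {C D : Set X} (h : boundaryOf C ⊆ boundaryOf D) :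
    boundaryOf (g • C) ⊆ boundaryOf (g • D) := by
  rintro ξ ⟨α, hα, rfl⟩
  obtain ⟨β, hβ, hβα⟩ := h ⟨α.translate g⁻¹, fun t => mem_smul_set_iff_inv_smul_mem.1 (hα t), rfl⟩
  refine ⟨β.translate g, fun t => smul_mem_smul_set (hβ t), ?_⟩
  rw [GeodesicRay.endpoint_translate g hβα]
  simp [GeodesicRay.translate]

theorem boundaryOf_smul_congr (g : Γ) {C D : Set X} (h : boundaryOf C = boundaryOf D) :
    boundaryOf (g • C) = boundaryOf (g • D) :=
  (boundaryOf_smul_subset g h.subset).antisymm (boundaryOf_smul_subset g h.symm.subset)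

theorem IsBoundaryMinimal.smul {C : Set X} (hC : IsBoundaryMinimal C) (hX : IsCAT0 X) (g : Γ) :
    IsBoundaryMinimal (g • C) := by
  refine ⟨hC.1.smul hX g, fun B hB hBC h => ?_⟩
  have h1 := boundaryOf_smul_congr g⁻¹ h
  rw [inv_smul_smul] at h1
  have h2 := hC.2 _ (hB.smul hX g⁻¹) (by
    rw [← inv_smul_smul g C]
    exact smul_set_mono hBC) h1
  rw [← h2, smul_inv_smul]

variable [ProperSpace X]

/-- In a cocompact closed convex set, the closed convex subsets with full boundary are uniformly
dense. -/
theorem IsClosedConvex.exists_infDist_le {Z K : Set X} (hZ : IsClosedConvex Z) (hX : IsCAT0 X)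
    (hinv : ∀ g : Γ, ∀ x ∈ Z, g • x ∈ Z) (hK : IsCompact K)
    (hcov : ∀ x ∈ Z, ∃ g : Γ, ∃ k ∈ K, g • k = x) :
    ∃ D : ℝ, ∀ B ⊆ Z, IsClosedConvex B → boundaryOf B = boundaryOf Z →
      ∀ y ∈ Z, Metric.infDist y B ≤ D := by
  by_contra! hcon
  -- Translate each far point so that its foot `k` on the translated subset lies in `K`; the
  -- segments from `k` to `z` then accumulate at a ray `ρ` of `Z`.
  have hsel : ∀ n : ℕ, ∃ (B : Set X) (k z : X), IsClosedConvex B ∧ boundaryOf B = boundaryOf Z ∧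
      k ∈ B ∧ k ∈ K ∧ k ∈ Z ∧ z ∈ Z ∧ (n : ℝ) < dist k z ∧ ∀ c ∈ B, dist k z ≤ dist z c := by
    intro n
    obtain ⟨B, hBZ, hB, hBb, y, hy, hn⟩ := hcon n
    have hp := hB.proj_mem y
    obtain ⟨g, k, hk, hgk⟩ := hcov _ (hBZ hp)
    have hk' : k = g⁻¹ • proj B y := by rw [← hgk, inv_smul_smul]
    have hd : dist k (g⁻¹ • y) = Metric.infDist y B := by
      rw [hk', dist_smul, hB.infDist_eq, dist_comm]
    refine ⟨g⁻¹ • B, k, g⁻¹ • y, hB.smul hX _, ?_, ?_, hk, ?_, hinv _ _ hy, ?_, ?_⟩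
    · rw [boundaryOf_smul_congr g⁻¹ hBb, smul_set_eq_of_invariant hinv]
    · rw [hk']; exact smul_mem_smul_set hp
    · rw [hk']; exact hinv _ _ (hBZ hp)
    · rwa [hd]
    · intro c hc
      rw [hd, ← infDist_smul_set g⁻¹ y B]
      exact Metric.infDist_le_dist_of_mem hc
  choose B k z hB hBb hkB hkK hkZ hz hn hmin using hsel
  obtain ⟨o, -⟩ := hZ.nonempty
  obtain ⟨R, hR⟩ := hK.isBounded.subset_closedBall o
  have hlen : Tendsto (fun n => dist (k n) (z n)) atTop atTop :=
    tendsto_atTop_mono (fun n => (hn n).le) tendsto_natCast_atTop_atTop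
  obtain ⟨ρ, hρ⟩ := hX.exists_limit_ray (fun n => hR (hkK n)) hlen
  have hρZ : ∀ t, ρ.toFun t ∈ Z := fun t => hZ.closed.mem_of_tendsto (hρ t)
    (Eventually.of_forall fun n => hZ.along_mem hX (hkZ n) (hz n) t.coe_nonneg)
  have hβ : ∀ n, ∃ β : GeodesicRay X, β.toFun 0 = k n ∧ (∀ t, β.toFun t ∈ B n) ∧
      β.endpoint = ρ.endpoint := fun n =>
    (hB n).exists_ray_of_mem_boundary hX ((hBb n).symm ▸ ⟨ρ, hρZ, rfl⟩) (hkB n)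
  choose β hβ0 hβB hβρ using hβ
  have h0 := (hρ 0).dist (tendsto_const_nhds (x := ρ.toFun 0))
  have h1 := (hρ 1).dist (tendsto_const_nhds (x := ρ.toFun 1))
  simp only [NNReal.coe_zero, hX.along_zero, dist_self, NNReal.coe_one] at h0 h1
  -- `B n` contains a ray from `k n` asymptotic to `ρ`. Its point at time 1 is near `ρ 1`, hence
  -- nearly one unit closer to `z n` than the foot `k n`, against the choice of the foot.
  have h2 : ∀ᶠ n in (hyperfilter ℕ : Filter ℕ), 1 ≤
      dist (hX.along (k n) (z n) 1) (ρ.toFun 1) + dist (k n) (ρ.toFun 0) := by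
    filter_upwards [(tendsto_atTop.1 hlen 1).filter_mono Nat.hyperfilter_le_atTop] with n h
    obtain ⟨M, hM⟩ := GeodesicRay.endpoint_eq_iff.1 (hβρ n)
    have h3 := hX.dist_ray_le hM 1
    have h4 := hmin n _ (hβB n 1)
    have h5 := hX.dist_along_right (k n) (z n) ⟨zero_le_one, h⟩
    rw [hβ0] at h3
    linarith [dist_triangle4 (z n) (hX.along (k n) (z n) 1) (ρ.toFun 1) ((β n).toFun 1),
      dist_comm (z n) (hX.along (k n) (z n) 1), dist_comm (ρ.toFun 1) ((β n).toFun 1)]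
  have h3 := ge_of_tendsto (h1.add h0) h2
  norm_num at h3

/-- The uniform `D` makes the intersection of a chain meet every ball `closedBall y D` with `y ∈ Z`;
it is therefore nonempty and keeps the full boundary. -/
theorem IsClosedConvex.exists_isBoundaryMinimal_subset {Z : Set X} (hZ : IsClosedConvex Z)
    (hX : IsCAT0 X) {D : ℝ} (hD : ∀ B ⊆ Z, IsClosedConvex B → boundaryOf B = boundaryOf Z →
      ∀ y ∈ Z, Metric.infDist y B ≤ D) :
    ∃ B ⊆ Z, IsBoundaryMinimal B ∧ boundaryOf B = boundaryOf Z := by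
  obtain ⟨B, hBZ, hB⟩ := zorn_superset_nonempty
    {C | IsClosedConvex C ∧ C ⊆ Z ∧ boundaryOf C = boundaryOf Z} (by
      intro c hcS hc hne
      have hmeet : ∀ y ∈ Z, (⋂₀ c ∩ Metric.closedBall y D).Nonempty := by
        intro y hy
        refine sInter_inter_nonempty hc hne (isCompact_closedBall y D)
          fun C hC => ⟨(hcS hC).1.closed, proj C y, (hcS hC).1.proj_mem y, ?_⟩
        rw [Metric.mem_closedBall, dist_comm, ← (hcS hC).1.infDist_eq]
        exact hD C (hcS hC).2.1 (hcS hC).1 (hcS hC).2.2 y hy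
      have hI : IsClosedConvex (⋂₀ c) := hX.isClosedConvex_sInter (fun C hC => (hcS hC).1)
        ((hmeet _ hZ.nonempty.some_mem).mono inter_subset_left)
      have hIZ : ⋂₀ c ⊆ Z :=
        (sInter_subset_of_mem hne.some_mem).trans (hcS hne.some_mem).2.1
      refine ⟨⋂₀ c, ⟨hI, hIZ, (boundaryOf_mono hIZ).antisymm
        (hI.boundaryOf_subset hX (R := D) fun y hy => ?_)⟩, fun s hs => sInter_subset_of_mem hs⟩
      obtain ⟨q, hq, hqy⟩ := hmeet y hy
      rw [Metric.mem_closedBall, dist_comm] at hqy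
      exact (Metric.infDist_le_dist_of_mem hq).trans hqy) Z ⟨hZ, Subset.rfl, rfl⟩
  exact ⟨B, hBZ, ⟨hB.prop.1, fun C hC hCB h =>
    hCB.antisymm (hB.le_of_le ⟨hC, hCB.trans hBZ, h.trans hB.prop.2.2⟩ hCB)⟩, hB.prop.2.2⟩

/-- A minimal invariant closed convex set is boundary minimal. -/
theorem IsClosedConvex.isBoundaryMinimal_of_minimal_invariant {Z : Set X} (hZ : IsClosedConvex Z)
    (hX : IsCAT0 X) (hinv : ∀ g : Γ, ∀ x ∈ Z, g • x ∈ Z)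
    (hmin : ∀ B ⊆ Z, IsClosedConvex B → (∀ g : Γ, ∀ x ∈ B, g • x ∈ B) → B = Z) {D : ℝ}
    (hD : ∀ B ⊆ Z, IsClosedConvex B → boundaryOf B = boundaryOf Z →
      ∀ y ∈ Z, Metric.infDist y B ≤ D) : IsBoundaryMinimal Z := by
  obtain ⟨B, hBZ, hB, hBb⟩ := hZ.exists_isBoundaryMinimal_subset hX hD
  have hgZ : ∀ g : Γ, g • B ⊆ Z := fun g => by
    rw [← smul_set_eq_of_invariant hinv g]
    exact smul_set_mono hBZ
  have hgb : ∀ g : Γ, boundaryOf (g • B) = boundaryOf Z := fun g => by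
    rw [boundaryOf_smul_congr g hBb, smul_set_eq_of_invariant hinv]
  have hgB : ∀ g : Γ, IsBoundaryMinimal (g • B) := fun g => hB.smul hX g
  -- The group permutes the translates of `B`, so this sublevel set is invariant and minimality of
  -- `Z` applies.
  have hsub : ∀ c : ℝ, ∀ x ∈ Z, (∀ g : Γ, Metric.infDist x (g • B) ≤ c) →
      ∀ y ∈ Z, ∀ g : Γ, Metric.infDist y (g • B) ≤ c := by
    intro c x hx hxc y hy
    have := hmin {y ∈ Z | ∀ g : Γ, Metric.infDist y (g • B) ≤ c} (fun y hy => hy.1)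
      { nonempty := ⟨x, hx, hxc⟩
        closed := by
          refine hZ.closed.inter (s₂ := {y | ∀ g : Γ, Metric.infDist y (g • B) ≤ c}) ?_
          rw [ofPred_forall]
          exact isClosed_iInter fun g =>
            isClosed_le (Metric.continuous_infDist_pt _) continuous_const
        convex := by
          rw [hX.isGeodConvex_iff]
          intro y hy z hz s hs
          refine ⟨hZ.mix_mem hX hy.1 hz.1 hs, fun g => ?_⟩
          refine ((hgB g).1.infDist_convex hX univ y trivial z trivial s hs).trans ?_
          nlinarith [hy.2 g, hz.2 g, hs.1, hs.2] }
      (fun h y hy => ⟨hinv h y hy.1, fun g => by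
        rw [← infDist_smul_set h⁻¹, inv_smul_smul, smul_smul]
        exact hy.2 _⟩)
    rw [← this] at hy
    exact hy.2
  have hs : (1 / 2 : ℝ) ∈ Icc (0 : ℝ) 1 := by constructor <;> norm_num
  have hzero : ∀ b ∈ B, ∀ h : Γ, Metric.infDist b (h • B) = 0 := by
    intro b hb h
    have hbdd : BddAbove (range fun g : Γ => Metric.infDist b (g • B)) := by
      refine ⟨D, ?_⟩
      rintro _ ⟨g, rfl⟩
      exact hD _ (hgZ g) (hgB g).1 (hgb g) b (hBZ hb)
    set E := ⨆ g : Γ, Metric.infDist b (g • B) with hE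
    have hbE : ∀ g : Γ, Metric.infDist b (g • B) ≤ E := fun g => le_ciSup hbdd g
    have hE0 : 0 ≤ E := Metric.infDist_nonneg.trans (hbE h)
    have hZE := hsub E b (hBZ hb) hbE
    set δ := Metric.infDist b (h • B) with hδ
    have hδ0 : 0 ≤ δ := Metric.infDist_nonneg
    have hδE : δ ≤ E := hbE h
    have hphB := (hgB h).1.proj_mem b
    -- Both endpoints have the same foot in `g • B`, by trivial holonomy, and lie within `E` of it;
    -- CN at that foot gains `δ ^ 2 / 4`.
    have hmid : ∀ g : Γ, Metric.infDist (hX.mix b (proj (h • B) b) (1 / 2)) (g • B) ≤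
        Real.sqrt (E ^ 2 - δ ^ 2 / 4) := by
      intro g
      refine (Metric.infDist_le_dist_of_mem ((hgB g).1.proj_mem b)).trans ?_
      apply Real.le_sqrt_of_sq_le
      have h1 := hX.cn_mix b (proj (h • B) b) (proj (g • B) b) hs
      have h2 := hbE g
      have h3 := hZE _ (hgZ h hphB) g
      rw [(hgB g).1.infDist_eq] at h2 h3
      rw [hB.proj_proj_eq (hgB h) (hgB g) hX (hBb.trans (hgb h).symm) (hBb.trans (hgb g).symm) hb]
        at h3
      rw [← (hgB h).1.infDist_eq b, ← hδ] at h1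
      have h4 := pow_le_pow_left₀ dist_nonneg h2 2
      have h5 := pow_le_pow_left₀ dist_nonneg h3 2
      linarith
    -- The better bound at the midpoint passes back to `b`, whose supremum is `E`; hence `δ = 0`.
    have h6 := hsub _ _ (hZ.mix_mem hX (hBZ hb) (hgZ h hphB) hs) hmid b (hBZ hb)
    have : Nonempty Γ := ⟨1⟩
    have h7 : E ≤ Real.sqrt (E ^ 2 - δ ^ 2 / 4) := ciSup_le h6
    have hnn : 0 ≤ E ^ 2 - δ ^ 2 / 4 := by nlinarith
    have h8 := pow_le_pow_left₀ hE0 h7 2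
    rw [Real.sq_sqrt hnn] at h8
    exact (pow_eq_zero_iff two_ne_zero).1 (le_antisymm (by linarith) (sq_nonneg δ))
  have hBinv : ∀ g : Γ, ∀ x ∈ B, g • x ∈ B := by
    intro g x hx
    have h1 := ((hgB g⁻¹).1.closed.mem_iff_infDist_zero (hgB g⁻¹).1.nonempty).2 (hzero x hx g⁻¹)
    simpa [mem_smul_set_iff_inv_smul_mem] using h1
  rwa [← hmin B hBZ hB.1 hBinv]

end Groups

/-! ### The boundary of a cocompact invariant set is the limit set. -/

section LimitSets

open Filter

universe u

variable {X : Type u} [MetricSpace X]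

theorem IsCAT0.isClosedConvex_univ (hX : IsCAT0 X) (x : X) :
    IsClosedConvex (univ : Set X) :=
  ⟨⟨x, trivial⟩, isClosed_univ, hX.isGeodConvex_iff.2 fun _ _ _ _ _ _ => trivial⟩

theorem IsCAT0.toFun_eq (hX : IsCAT0 X) {α β : GeodesicRay X} (h0 : α.toFun 0 = β.toFun 0)
    (h : α.endpoint = β.endpoint) (t : ℝ≥0) : α.toFun t = β.toFun t := by
  obtain ⟨K, hK⟩ := GeodesicRay.endpoint_eq_iff.1 h
  have := hX.dist_ray_le hK t
  rw [h0, dist_self] at this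
  exact dist_le_zero.1 this

variable [ProperSpace X]

theorem IsCAT0.exists_ray_endpoint_eq (hX : IsCAT0 X) (x : X) (ξ : Boundary X) :
    ∃ α : GeodesicRay X, α.toFun 0 = x ∧ α.endpoint = ξ := by
  obtain ⟨α, rfl⟩ := Quotient.exists_rep ξ
  obtain ⟨β, h0, -, h⟩ := (hX.isClosedConvex_univ x).exists_ray_of_mem_boundary hX
    (ξ := α.endpoint) ⟨α, fun _ => trivial, rfl⟩ (mem_univ x)
  exact ⟨β, h0, h⟩

variable {Γ : Type*} [Group Γ] [MulAction Γ X] [IsIsometricSMul Γ X] {Z : Set X}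

theorem IsClosedConvex.limitSet_subset (hZ : IsClosedConvex Z) (hX : IsCAT0 X)
    (hinv : ∀ g : Γ, ∀ x ∈ Z, g • x ∈ Z) (x₀ x : X) : limitSet Γ x₀ x ⊆ boundaryOf Z := by
  intro ξ hξ
  obtain ⟨α, hα0, rfl⟩ := hX.exists_ray_endpoint_eq x₀ ξ
  obtain ⟨z, hz⟩ := hZ.nonempty
  -- Basic neighbourhoods need a positive radius, hence `n + 1`. The `2` is the width 1 of the
  -- neighbourhood plus the step from `n + 1` back to `n`.
  obtain ⟨β, -, hβ, hβα⟩ := hZ.exists_ray hX α (R := dist x₀ z + dist x z + 2) (fun n => by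
    obtain ⟨w, hw, y, ⟨g, rfl⟩, rfl⟩ := (@mem_closure_iff _ (coneTopology x₀) _ _).1 hξ
      (coneNhd x₀ α (n + 1) 1) (TopologicalSpace.isOpen_generateFrom_of_mem
        (Or.inr ⟨α, n + 1, 1, hα0, by positivity, one_pos, rfl⟩))
      (Or.inr ⟨_, ⟨α, hα0, rfl, by simp⟩, rfl⟩)
    rcases hw with ⟨_, ⟨hlt, γ, hγ, hd⟩, hy⟩ | ⟨_, -, hy⟩
    · cases hy
      beta_reduce at hlt hγ
      have hlt' : (((n + 1 : ℝ≥0) : ℝ)) ∈ Icc (0 : ℝ) (dist x₀ (g • x)) :=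
        ⟨NNReal.coe_nonneg _, hlt.le⟩
      have hs := min_div_mem hlt'.1 (dist_nonneg (x := x₀) (y := g • x))
      refine ⟨_, hZ.mix_mem hX hz (hinv g z hz) hs, ?_⟩
      have h1 := hX.dist_mix_le x₀ (g • x) z (g • z) hs
      rw [dist_smul] at h1
      rw [hX.seg_eq_along hγ hlt', IsCAT0.along] at hd
      set s := min 1 (((n + 1 : ℝ≥0) : ℝ) / dist x₀ (g • x))
      have h2 := mul_le_of_le_one_left (dist_nonneg (x := x) (y := z)) hs.2
      have h3 := mul_le_of_le_one_left (dist_nonneg (x := x₀) (y := z))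
        (show 1 - s ≤ 1 by linarith [hs.1])
      have h4 : dist (α.toFun (n + 1)) (α.toFun n) = 1 := by
        rw [α.dist_eq]; push_cast; simp
      have h5 := dist_triangle4 (hX.mix z (g • z) s) (hX.mix x₀ (g • x) s) (α.toFun (n + 1))
        (α.toFun n)
      rw [dist_comm (hX.mix z (g • z) s) (hX.mix x₀ (g • x) s),
        dist_comm (hX.mix x₀ (g • x) s) (α.toFun (n + 1))] at h5
      linarith
    · cases hy) hz
  exact ⟨β, hβ, hβα⟩

theorem boundaryOf_subset_limitSet (hX : IsCAT0 X) {K : Set X} (hK : IsCompact K)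
    (hcov : ∀ x ∈ Z, ∃ g : Γ, ∃ k ∈ K, g • k = x) (x₀ x : X) :
    boundaryOf Z ⊆ limitSet Γ x₀ x := by
  rintro ξ ⟨ρ, hρ, rfl⟩
  obtain ⟨α, hα0, hα⟩ := hX.exists_ray_endpoint_eq x₀ ρ.endpoint
  obtain ⟨M, hM⟩ := GeodesicRay.endpoint_eq_iff.1 hα
  obtain ⟨R, hR⟩ := hK.isBounded.subset_closedBall x
  have hsel : ∀ n : ℕ, ∃ g : Γ, dist (α.toFun n) (g • x) ≤ M + R := fun n => by
    obtain ⟨g, k, hk, hgk⟩ := hcov _ (hρ n)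
    refine ⟨g, (dist_triangle _ (ρ.toFun n) _).trans (add_le_add (hM n) ?_)⟩
    rw [← hgk, dist_smul]
    exact hR hk
  choose g hg using hsel
  let := coneTopology x₀
  refine mem_closure_of_tendsto (X := X ⊕ Boundary X) (f := fun n => Sum.inl (g n • x))
    (b := atTop) ?_ (Eventually.of_forall fun n => ⟨_, ⟨g n, rfl⟩, rfl⟩)
  rw [TopologicalSpace.tendsto_nhds_generateFrom_iff]
  rintro s (⟨y, r, rfl⟩ | ⟨α', n, ε, hα', hn, hε, rfl⟩) hs
  · obtain ⟨_, -, h⟩ := hs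
    cases h
  · rcases hs with ⟨_, -, h⟩ | ⟨η, ⟨β, hβ0, hβ, hd⟩, h⟩
    · cases h
    · cases h
      rw [hX.toFun_eq (hβ0.trans hα0.symm) (hβ.trans hα.symm) n] at hd
      -- The orbit points stay within `M + R` of `α N`; seen at distance `n` from `x₀`, this gap
      -- shrinks like `n / N`.
      have hlim : Tendsto (fun N : ℕ => 2 * ((n : ℝ) * (M + R) / N)) atTop (𝓝 0) := by
        simpa using (tendsto_const_div_atTop_nhds_zero_nat ((n : ℝ) * (M + R))).const_mul 2
      filter_upwards [hlim.eventually (gt_mem_nhds (sub_pos.2 hd)),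
        tendsto_natCast_atTop_atTop.eventually_gt_atTop ((n : ℝ) + (M + R)),
        tendsto_natCast_atTop_atTop.eventually_ge_atTop (n : ℝ),
        eventually_gt_atTop 0] with N h1 h2 h3 h4
      have hN : dist x₀ (α.toFun N) = N := by rw [← hα0, α.dist_zero]; simp
      have hlen : (n : ℝ) < dist x₀ (g N • x) := by
        linarith [dist_triangle_right x₀ (α.toFun N) (g N • x), hg N]
      refine Or.inl ⟨_, ⟨hlen, _, hX.isGeodesicSegment_along _ _, ?_⟩, rfl⟩
      have hnN : n ≤ (N : ℝ≥0) := by exact_mod_cast h3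
      have h5 := hX.dist_along_le x₀ (α.toFun N) x₀ (g N • x) n.coe_nonneg (hN.symm ▸ h3) hlen.le
      have h6 := α.eq_along hX hnN
      rw [hα0] at h6
      rw [← h6, dist_self, zero_add, hN] at h5
      have h7 : min 1 ((n : ℝ) / N) * dist (α.toFun N) (g N • x) ≤ (n : ℝ) * (M + R) / N := by
        rw [← div_mul_eq_mul_div]
        exact mul_le_mul (min_le_right _ _) (hg N) dist_nonneg (by positivity)
      linarith [dist_triangle (α'.toFun n) (α.toFun n) (hX.along x₀ (g N • x) n)]

end LimitSets

end CatZero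

theorem mainTheorem10 {X G : Type*} [MetricSpace X] [ProperSpace X] [Group G] [MulAction G X]
    (hX : CatZero.IsCAT0 X)
    (hG : CatZero.ActsGeometricallyOn G (Set.univ : Set X))
    (H : Subgroup G) (hH : CatZero.IsConvexSubgroup X H) :
    (∃ Z : Set X, CatZero.IsBoundaryMinimal Z ∧
      (∀ x₀ x : X, CatZero.boundaryOf Z = CatZero.limitSet H x₀ x) ∧
      CatZero.ActsGeometricallyOn H Z) ∧
    (∀ A B : Set X, CatZero.IsBoundaryMinimal A → CatZero.IsBoundaryMinimal B →
      CatZero.boundaryOf A = CatZero.boundaryOf B → CatZero.Parallel A B) := by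
  refine ⟨?_, fun A B hA hB h => hA.parallel hB hX h⟩
  have : IsIsometricSMul H X :=
    ⟨fun h => Isometry.of_dist_eq fun x y => hG.isometric (h : G) x trivial y trivial⟩
  obtain ⟨Y, hY, hact⟩ := hH
  obtain ⟨K, -, hK, hcov⟩ := hact.cocompact
  obtain ⟨Z, hZY, hZ, hinv, hmin⟩ := hY.exists_minimal_invariant hX hact.invariant hK hcov
  have hcovZ : ∀ x ∈ Z, ∃ h : H, ∃ k ∈ K, h • k = x := fun x hx => hcov x (hZY hx)
  obtain ⟨D, hD⟩ := hZ.exists_infDist_le hX hinv hK hcovZ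
  refine ⟨Z, hZ.isBoundaryMinimal_of_minimal_invariant hX hinv hmin hD, fun x₀ x =>
    (CatZero.boundaryOf_subset_limitSet hX hK hcovZ x₀ x).antisymm
      (hZ.limitSet_subset hX hinv x₀ x), hinv, fun h x _ y _ => dist_smul h x y,
    -- `K` need not lie in `Z`, but `K ∩ Z` still covers: by invariance, `k` lies in `Z` when `h •
    -- k` does.
    fun L hL => hact.proper L (hL.trans hZY), K ∩ Z, Set.inter_subset_right,
    hK.inter_right hZ.closed, fun x hx => ?_⟩
  obtain ⟨h, k, hk, rfl⟩ := hcovZ x hx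
  exact ⟨h, k, ⟨hk, by simpa using hinv h⁻¹ _ hx⟩, rfl⟩
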